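/- Let $\mathbb{K}$ be a field, $r\in\mathbb{N}$, and order $\mathbf{R}^r=(\mathbb{R}_{\ge 0})^r$ componentwise. A persistence module is a functor $M\colon \mathbf{R}^r\to \mathrm{Vect}_{\mathbb{K}}$ (equivalently, an $\mathbf{R}^r$-graded $\mathbb{K}[\mathbf{R}^r]$-module); it is tame if it is finitely presented. Let $\beta_0(M)$ denote the smallest rank of a free persistence module surjecting onto $M$. For $w\in\mathbf{R}^r$ let $\dim_w(M)$ be the smallest $k$ such that there are homogeneous elements $m_1,\dots,m_k$ of $M$ with $w*(M/\langle m_1,\dots,m_k\rangle)=0$, i.e. all maps $N(a\le a+w)$ of $N=M/\langle m_1,\dots,m_k\rangle$ vanish. Let $v,\alpha\in\mathbf{R}^r$ (for example with $v$ of norm $1$). The $\alpha$-truncated standard contour in the direction of $v$ is the function $C_\alpha\colon (\mathbf{R}^r\cup\{\infty\})\times\mathbb{R}_{\ge 0}\to \mathbf{R}^r\cup\{\infty\}$ given by $C_\alpha(x,\varepsilon)=x+\varepsilon v$ if $\alpha\not\le x+\varepsilon v$ and $C_\alpha(x,\varepsilon)=\infty$ otherwise. Its noise system is $\{\mathcal{V}_\varepsilon\}_{\varepsilon\ge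 0}$, where $\mathcal{V}_\varepsilon$ is the set of tame $N$ such that $N(x\le C_\alpha(x,\varepsilon))=0$ for all $x\in\mathbf{R}^r$ with $C_\alpha(x,\varepsilon)\ne\infty$. A morphism $f$ of tame modules is an $\varepsilon$-equivalence for this noise system if there are $\tau,\mu\ge 0$ with $\tau+\mu\le\varepsilon$, $\ker f\in\mathcal{V}_\tau$ and $\operatorname{coker} f\in\mathcal{V}_\mu$. Tame modules $M,N$ are $\varepsilon$-close if there are a tame $L$, an $\varepsilon_1$-equivalence $M\to L$ and an $\varepsilon_2$-equivalence $N\to L$ with $\varepsilon_1+\varepsilon_2\le\varepsilon$; let $d(M,N)\in[0,\infty]$ be the infimum of all such $\varepsilon$. The hierarchical stabilization of $\beta_0$ with respect to the $\alpha$-truncated noise in the direction of $v$ is $$\widehat{\beta_0}_{v,\alpha}(M)(\delta)=\min\{\beta_0(N)\mid N \text{ tame},\ d(M,N)\le\delta\}.$$ Then for every tame persistence module $M$ and every $\delta\ge 0$, $$\widehat{\beta_0}_{v,\alpha}(M)(\delta)=\dim_{\delta v}\Bigl(M\big/\bigoplus_{\beta\ge\alpha}M_\beta\Bigr).$$ 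-/

import Mathlib

open CategoryTheory
open scoped NNReal ENNReal

universe u

/-- The set `ℝ_{≥0}^r` of degrees, with the componentwise order. (A type synonym, so that its
category structure is the posetal one.) -/
def Deg (r : ℕ) : Type := Fin r → ℝ≥0

instance (r : ℕ) : PartialOrder (Deg r) := inferInstanceAs (PartialOrder (Fin r → ℝ≥0))

instance (r : ℕ) : AddCommMonoid (Deg r) := inferInstanceAs (AddCommMonoid (Fin r → ℝ≥0))

instance (r : ℕ) : Module ℝ≥0 (Deg r) := inferInstanceAs (Module ℝ≥0 (Fin r → ℝ≥0))

theorem Deg.le_add {r : ℕ} (a v : Deg r) : a ≤ a + v :=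
  fun _ => le_add_of_nonneg_right zero_le

/-- Multiparameter persistence modules over the field `K`. -/
abbrev PersMod (K : Type u) [Field K] (r : ℕ) : Type (u + 1) :=
  Deg r ⥤ ModuleCat.{u} K

/-! ### Free modules, tameness and the zeroth Betti number -/

/-- The free persistence module `⨁ᵢ K(dᵢ, •)`: its value at `h` has as a basis the indices `i` with
`dᵢ ≤ h`, and the structure maps are the inclusions. -/
noncomputable def freeMod (K : Type u) [Field K] {r n : ℕ} (d : Fin n → Deg r) : PersMod K r where
  obj h := ModuleCat.of K ({i : Fin n // d i ≤ h} →₀ K)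
  map {h h'} f := ModuleCat.ofHom (Finsupp.lmapDomain K K
    (fun i : {i : Fin n // d i ≤ h} =>
      (⟨i.1, i.2.trans (leOfHom f)⟩ : {i : Fin n // d i ≤ h'})))
  map_id h := by
    apply ModuleCat.hom_ext
    apply LinearMap.ext
    intro x
    exact Finsupp.mapDomain_id
  map_comp f g := by
    apply ModuleCat.hom_ext
    apply LinearMap.ext
    intro x
    exact Finsupp.mapDomain_comp (v := x)
      (f := fun i : {i : Fin n // d i ≤ _} => (⟨i.1, i.2.trans (leOfHom f)⟩ : {i // d i ≤ _}))
      (g := fun i : {i : Fin n // d i ≤ _} => (⟨i.1, i.2.trans (leOfHom g)⟩ : {i // d i ≤ _}))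

/-- Tame persistence modules: those with a finite presentation
`⨁ⱼ K(eⱼ, •) → ⨁ᵢ K(dᵢ, •) → M → 0`. -/
def IsTame {K : Type u} [Field K] {r : ℕ} (M : PersMod K r) : Prop :=
  ∃ (m n : ℕ) (e : Fin m → Deg r) (d : Fin n → Deg r)
    (q : freeMod K e ⟶ freeMod K d) (p : freeMod K d ⟶ M),
    ∀ a : Deg r, Function.Exact (q.app a) (p.app a) ∧ Function.Surjective (p.app a)

/-- Tame persistence modules, as a type. -/
abbrev TameMod (K : Type u) [Field K] (r : ℕ) : Type (u + 1) :=
  {M : PersMod K r // IsTame M}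

/-- The total zeroth multigraded Betti number: the smallest rank of a free module surjecting
onto `M`. -/
noncomputable def betti₀ {K : Type u} [Field K] {r : ℕ} (M : PersMod K r) : ℕ :=
  sInf {n : ℕ | ∃ (d : Fin n → Deg r) (p : freeMod K d ⟶ M),
    ∀ a : Deg r, Function.Surjective (p.app a)}

/-! ### Submodules, quotients and the shift-dimension -/

/-- Graded submodules (subfunctors) of a persistence module. -/
structure GrSub {K : Type u} [Field K] {r : ℕ} (M : PersMod K r) where
  /-- the homogeneous component of degree `a` -/
  comp : ∀ a : Deg r, Submodule K (M.obj a)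
  map_mem : ∀ {a b : Deg r} (f : a ⟶ b), comp a ≤ (comp b).comap (M.map f).hom

/-- The quotient `M / S` of a persistence module by a graded submodule. -/
noncomputable def GrSub.quotient {K : Type u} [Field K] {r : ℕ} {M : PersMod K r} (S : GrSub M) :
    PersMod K r where
  obj a := ModuleCat.of K (M.obj a ⧸ S.comp a)
  map {a b} f := ModuleCat.ofHom ((S.comp a).mapQ (S.comp b) (M.map f).hom (S.map_mem f))
  map_id a := by
    ext x
    simp
  map_comp f g := by
    ext x
    simp

/-- The graded submodule `⟨m₁, …, mₖ⟩` generated by homogeneous elements `mᵢ` of degrees `dᵢ`. -/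
def GrSub.generated {K : Type u} [Field K] {r : ℕ} (M : PersMod K r) {k : ℕ}
    (d : Fin k → Deg r) (m : ∀ i, M.obj (d i)) : GrSub M where
  comp b := Submodule.span K {x | ∃ (i : Fin k) (f : d i ⟶ b), x = (M.map f).hom (m i)}
  map_mem {a b} f := by
    rw [Submodule.span_le]
    rintro x ⟨i, g, rfl⟩
    exact Submodule.subset_span ⟨i, g ≫ f, by simp⟩

/-- The graded submodule `⨁_{β ≥ α} M_β`. -/
noncomputable def GrSub.above {K : Type u} [Field K] {r : ℕ} (M : PersMod K r) (α : Deg r) :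
    GrSub M where
  comp b := ⨆ _ : α ≤ b, ⊤
  map_mem {a b} f := iSup_le fun h => by
    rw [iSup_pos (h.trans (leOfHom f))]
    exact le_top

/-- `v * N = 0`, i.e. multiplication by `v` annihilates `N`. -/
def ShiftZero {K : Type u} [Field K] {r : ℕ} (v : Deg r) (N : PersMod K r) : Prop :=
  ∀ a : Deg r, N.map (homOfLE (Deg.le_add a v)) = 0

/-- The shift-dimension `dim_v M`: the smallest number of homogeneous elements `m₁, …, mₖ` of `M`
with `v * (M / ⟨m₁, …, mₖ⟩) = 0`. -/
noncomputable def shiftDim {K : Type u} [Field K] {r : ℕ} (v : Deg r) (M : PersMod K r) : ℕ :=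
  sInf {k : ℕ | ∃ (d : Fin k → Deg r) (m : ∀ i, M.obj (d i)),
    ShiftZero v (GrSub.generated M d m).quotient}

/-! ### Persistence contours -/

/-- Persistence contours `C : ℝ_{≥0}^r ∪ {∞} × ℝ_{≥0} → ℝ_{≥0}^r ∪ {∞}`. -/
structure Contour (r : ℕ) where
  toFun : WithTop (Deg r) → ℝ≥0 → WithTop (Deg r)
  mono : ∀ {x y : WithTop (Deg r)} {ε τ : ℝ≥0}, x ≤ y → ε ≤ τ → toFun x ε ≤ toFun y τ
  le : ∀ (x : WithTop (Deg r)) (ε : ℝ≥0), x ≤ toFun x ε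
  lax : ∀ (x : WithTop (Deg r)) (ε τ : ℝ≥0), toFun (toFun x ε) τ ≤ toFun x (ε + τ)

/-- The standard contour `C(x, ε) = x + ε v` in the direction of `v`. -/
def standardContour {r : ℕ} (v : Deg r) : Contour r where
  toFun x ε := WithTop.map (fun a : Deg r => a + ε • v) x
  mono {x y ε τ} hxy hε := by
    induction y with
    | top => simp
    | coe y =>
      induction x with
      | top => simp at hxy
      | coe x =>
        simp only [WithTop.map_coe, WithTop.coe_le_coe] at hxy ⊢
        exact fun i => add_le_add (hxy i) (mul_le_mul_left hε (v i))
  le x ε := by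
    induction x with
    | top => simp
    | coe x => exact WithTop.coe_le_coe.2 (Deg.le_add _ _)
  lax x ε τ := by
    induction x with
    | top => simp
    | coe x =>
      change ((x + ε • v + τ • v : Deg r) : WithTop (Deg r)) ≤ ((x + (ε + τ) • v : Deg r) : _)
      rw [add_smul, add_assoc]

open Classical in
/-- The truncation `C_α` of a contour `C` at `α`. -/
noncomputable def Contour.truncate {r : ℕ} (C : Contour r) (α : Deg r) : Contour r where
  toFun x ε := if ¬ (α : WithTop (Deg r)) ≤ C.toFun x ε then C.toFun x ε else ⊤
  mono {x y ε τ} hxy hε := by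
    have h := C.mono hxy hε
    by_cases hy : (α : WithTop (Deg r)) ≤ C.toFun y τ
    · simp [hy]
    · have hx : ¬ (α : WithTop (Deg r)) ≤ C.toFun x ε := fun hx => hy (hx.trans h)
      simpa [hx, hy] using h
  le x ε := by
    split_ifs
    · exact le_top
    · exact C.le x ε
  lax x ε τ := by
    by_cases hy : (α : WithTop (Deg r)) ≤ C.toFun x (ε + τ)
    · simp [hy]
    · have h := C.lax x ε τ
      have hx : ¬ (α : WithTop (Deg r)) ≤ C.toFun (C.toFun x ε) τ := fun hx => hy (hx.trans h)
      have hx' : ¬ (α : WithTop (Deg r)) ≤ C.toFun x ε :=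
        fun hx' => hx (hx'.trans (C.le _ _))
      simpa [hx, hx', hy] using h

/-! ### Noise systems, their pseudometrics and hierarchical stabilization -/

/-- The noise system `{𝒱_{C,ε}}_ε` of a contour `C`: the tame modules `M` for which
`M(x ≤ C(x, ε))` is zero whenever `C(x, ε) ≠ ∞`. -/
def Contour.noise (K : Type u) [Field K] {r : ℕ} (C : Contour r) (ε : ℝ≥0) : Set (PersMod K r) :=
  {M | IsTame M ∧ ∀ (x y : Deg r) (hxy : x ≤ y),
    C.toFun (x : WithTop (Deg r)) ε = (y : WithTop (Deg r)) → M.map (homOfLE hxy) = 0}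

/-- `f` is an `ε`-equivalence for the noise system `𝒱`: there are `τ + μ ≤ ε` with `ker f ∈ 𝒱_τ`
and `coker f ∈ 𝒱_μ`. -/
def NoiseEquivalence {K : Type u} [Field K] {r : ℕ} (V : ℝ≥0 → Set (PersMod K r)) (ε : ℝ≥0)
    {M N : PersMod K r} (f : M ⟶ N) : Prop :=
  ∃ τ μ : ℝ≥0, τ + μ ≤ ε ∧ Limits.kernel f ∈ V τ ∧ Limits.cokernel f ∈ V μ

/-- `M` and `N` are `ε`-close for the noise system `𝒱`: there are a tame `L` and morphisms
`M → L ← N` that are an `ε₁`- and an `ε₂`-equivalence with `ε₁ + ε₂ ≤ ε`. -/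
def NoiseClose {K : Type u} [Field K] {r : ℕ} (V : ℝ≥0 → Set (PersMod K r)) (ε : ℝ≥0)
    (M N : TameMod K r) : Prop :=
  ∃ (L : TameMod K r) (f : M.1 ⟶ L.1) (g : N.1 ⟶ L.1) (ε₁ ε₂ : ℝ≥0),
    NoiseEquivalence V ε₁ f ∧ NoiseEquivalence V ε₂ g ∧ ε₁ + ε₂ ≤ ε

/-- The extended pseudometric of a noise system: the infimum of all `ε` for which `M` and `N` are
`ε`-close, and `∞` if there is none. -/
noncomputable def noiseDist {K : Type u} [Field K] {r : ℕ} (V : ℝ≥0 → Set (PersMod K r))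
    (M N : TameMod K r) : ℝ≥0∞ :=
  ⨅ (ε : ℝ≥0) (_ : NoiseClose V ε M N), (ε : ℝ≥0∞)

/-- The hierarchical stabilization `f̂(x)(τ) = min {f(y) | d(x, y) ≤ τ}` of a discrete invariant. -/
noncomputable def hierarchicalStabilization {T : Type*} (d : T → T → ℝ≥0∞) (f : T → ℕ) (x : T)
    (τ : ℝ≥0) : ℕ :=
  sInf {n : ℕ | ∃ y : T, d x y ≤ (τ : ℝ≥0∞) ∧ f y = n}

/-!
For a contour `C` and a graded submodule `S` of `M`, let the thickening of `S` by `C` at `ε` consist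
of the elements that the structure maps `M(a ≤ C(a, ε))` send into `S`. A module belongs to the
noise at `ε` exactly when the thickening of its zero submodule is everything, and thickening is
monotone, commutes with preimages and satisfies `(S^ε)^τ ⊆ S^(τ + ε)`.

If `M → L ← N` exhibits `M` and `N` as `ε`-close, a set of generators of `N` can therefore be moved
through `L` to equally many elements of `M` whose span thickens to `M` at `ε`. Conversely, if the
submodule `N` generated by `k` elements of `M` thickens to `M` at `δ`, then `N ⊆ M` has zero kernel
and a cokernel in the noise at `δ`. It remains to pass from all `ε > δ` to `δ`, because the distance
is an infimum: a tame module is constant on the cells of a finite grid, so the generators can be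
moved to the finitely many minimal points of cells, and for a right continuous contour the points
`C(a, ε)` and `C(a, δ)` lie in the same cell as soon as `ε` is close to `δ`.
-/

section

open scoped Topology

variable {K : Type u} [Field K] {r : ℕ} {M N L : PersMod K r}

/-! ### Structure maps and graded submodules -/

/-- The structure map `M(a ≤ b)` of a persistence module as a linear map. -/
noncomputable def PersMod.structMap (M : PersMod K r) {a b : Deg r} (h : a ≤ b) :
    M.obj a →ₗ[K] M.obj b :=
  (M.map (homOfLE h)).hom

theorem structMap_self (M : PersMod K r) {a : Deg r} (x : M.obj a) :
    M.structMap le_rfl x = x :=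
  congr($(M.map_id a) x)

theorem structMap_structMap (M : PersMod K r) {a b c : Deg r} (h : a ≤ b) (h' : b ≤ c)
    (x : M.obj a) : M.structMap h' (M.structMap h x) = M.structMap (h.trans h') x :=
  congr($(M.map_comp (homOfLE h) (homOfLE h')) x).symm

theorem app_structMap (f : M ⟶ N) {a b : Deg r} (h : a ≤ b) (x : M.obj a) :
    f.app b (M.structMap h x) = N.structMap h (f.app a x) :=
  NatTrans.naturality_apply f (homOfLE h) x

theorem map_eq_zero_iff_structMap (M : PersMod K r) {a b : Deg r} (h : a ≤ b) :
    M.map (homOfLE h) = 0 ↔ ∀ x, M.structMap h x = 0 :=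
  ⟨fun h0 x => congr($h0 x), fun h0 => ModuleCat.hom_ext (LinearMap.ext h0)⟩

namespace GrSub

attribute [ext] GrSub

instance : PartialOrder (GrSub M) :=
  PartialOrder.lift GrSub.comp fun _ _ => GrSub.ext

instance : BoundedOrder (GrSub M) where
  top := ⟨fun _ => ⊤, fun _ => le_top⟩
  bot := ⟨fun _ => ⊥, fun _ => bot_le⟩
  le_top _ _ := le_top
  bot_le _ _ := bot_le

theorem structMap_mem (S : GrSub M) {a b : Deg r} (h : a ≤ b) {x : M.obj a}
    (hx : x ∈ S.comp a) : M.structMap h x ∈ S.comp b :=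
  S.map_mem (homOfLE h) hx

/-- The image of a graded submodule under a morphism; `(⊤ : GrSub M).map f` is the range of `f`. -/
noncomputable def map (f : M ⟶ N) (S : GrSub M) : GrSub N where
  comp a := (S.comp a).map (f.app a).hom
  map_mem {_ _} h := by
    rintro _ ⟨x, hx, rfl⟩
    exact ⟨M.map h x, S.map_mem h hx, NatTrans.naturality_apply f h x⟩

/-- The preimage of a graded submodule under a morphism; `(⊥ : GrSub N).comap f` is the kernel
of `f`. -/
noncomputable def comap (f : M ⟶ N) (S : GrSub N) : GrSub M where
  comp a := (S.comp a).comap (f.app a).hom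
  map_mem {a b} h x hx := by
    change f.app b (M.map h x) ∈ S.comp b
    rw [NatTrans.naturality_apply]
    exact S.map_mem h hx

theorem map_le_iff_le_comap {f : M ⟶ N} {S : GrSub M} {T : GrSub N} :
    S.map f ≤ T ↔ S ≤ T.comap f :=
  forall_congr' fun _ => Submodule.map_le_iff_le_comap

theorem map_map (f : M ⟶ N) (g : N ⟶ L) (S : GrSub M) : (S.map f).map g = S.map (f ≫ g) :=
  GrSub.ext <| funext fun a => (Submodule.map_comp (f.app a).hom (g.app a).hom (S.comp a)).symm

theorem map_top_eq_top_iff {f : M ⟶ N} :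
    (⊤ : GrSub M).map f = ⊤ ↔ ∀ a, Function.Surjective (f.app a) :=
  GrSub.ext_iff.trans <| funext_iff.trans <| forall_congr' fun _ =>
    (Submodule.map_top _).congr_left.trans LinearMap.range_eq_top

theorem comap_bot_eq_bot_of_injective {f : M ⟶ N} (hf : ∀ a, Function.Injective (f.app a)) :
    (⊥ : GrSub N).comap f = ⊥ :=
  GrSub.ext <| funext fun a => LinearMap.ker_eq_bot.2 (hf a)

theorem comap_eq_top_iff_of_surjective {f : M ⟶ N} (hf : ∀ a, Function.Surjective (f.app a))
    {S : GrSub N} : S.comap f = ⊤ ↔ S = ⊤ := by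
  rw [← top_le_iff, ← map_le_iff_le_comap, map_top_eq_top_iff.2 hf, top_le_iff]

theorem comap_bot_eq_map_top {f : M ⟶ N} {g : N ⟶ L}
    (h : ∀ a, Function.Exact (f.app a) (g.app a)) :
    (⊥ : GrSub L).comap g = (⊤ : GrSub M).map f :=
  GrSub.ext <| funext fun a =>
    (LinearMap.exact_iff.1 (h a)).trans (Submodule.map_top (f.app a).hom).symm

/-- The projection of a persistence module onto its quotient by a graded submodule. -/
noncomputable def mkQ (S : GrSub M) : M ⟶ S.quotient where
  app a := ModuleCat.ofHom (S.comp a).mkQ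
  naturality _ _ _ := rfl

theorem mkQ_surjective (S : GrSub M) (a : Deg r) : Function.Surjective (S.mkQ.app a) :=
  Submodule.mkQ_surjective _

theorem comap_mkQ_bot (S : GrSub M) : (⊥ : GrSub S.quotient).comap S.mkQ = S :=
  GrSub.ext <| funext fun a => Submodule.ker_mkQ (S.comp a)

theorem comap_map_mkQ_comp (S T : GrSub M) (a : Deg r) :
    ((S.map T.mkQ).comap T.mkQ).comp a = T.comp a ⊔ S.comp a :=
  Submodule.comap_map_mkQ _ _

theorem above_comp_of_le {α a : Deg r} (h : α ≤ a) : (above M α).comp a = ⊤ :=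
  iSup_pos h

theorem above_comp_of_not_le {α a : Deg r} (h : ¬ α ≤ a) : (above M α).comp a = ⊥ :=
  iSup_neg h

theorem mem_generated {k : ℕ} (d : Fin k → Deg r) (m : ∀ i, M.obj (d i)) (i : Fin k) :
    m i ∈ (generated M d m).comp (d i) :=
  Submodule.subset_span ⟨i, 𝟙 _, by simp⟩

theorem generated_le_iff {k : ℕ} {d : Fin k → Deg r} {m : ∀ i, M.obj (d i)} {S : GrSub M} :
    generated M d m ≤ S ↔ ∀ i, m i ∈ S.comp (d i) := by
  refine ⟨fun h i => h _ (mem_generated d m i), fun h a => Submodule.span_le.2 ?_⟩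
  rintro _ ⟨i, f, rfl⟩
  exact S.map_mem f (h i)

theorem map_generated (f : M ⟶ N) {k : ℕ} (d : Fin k → Deg r) (m : ∀ i, M.obj (d i)) :
    (generated M d m).map f = generated N d fun i => f.app (d i) (m i) :=
  le_antisymm
    (map_le_iff_le_comap.2 <| generated_le_iff.2 <| mem_generated d fun i => f.app (d i) (m i))
    (generated_le_iff.2 fun i => ⟨m i, mem_generated d m i, rfl⟩)

end GrSub

/-! ### Free modules and generators -/

/-- The `i`-th generator of a free persistence module. -/
noncomputable def freeGen {n : ℕ} (d : Fin n → Deg r) (i : Fin n) : (freeMod K d).obj (d i) :=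
  (Finsupp.single ⟨i, le_rfl⟩ 1 : {j : Fin n // d j ≤ d i} →₀ K)

theorem structMap_freeGen {n : ℕ} (d : Fin n → Deg r) {a : Deg r} (i : {i : Fin n // d i ≤ a}) :
    (freeMod K d).structMap i.2 (freeGen d i.1) =
      (Finsupp.single i 1 : {i : Fin n // d i ≤ a} →₀ K) :=
  Finsupp.mapDomain_single

theorem generated_freeGen {n : ℕ} (d : Fin n → Deg r) :
    GrSub.generated (freeMod K d) d (freeGen d) = ⊤ := by
  refine top_le_iff.1 fun a => ?_
  have span_eq : Submodule.span K (Set.range fun i : {i : Fin n // d i ≤ a} =>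
      (freeMod K d).structMap i.2 (freeGen d i.1)) = ⊤ := by
    simp only [structMap_freeGen]
    exact Finsupp.basisSingleOne.span_eq
  refine span_eq.ge.trans (Submodule.span_le.2 ?_)
  rintro _ ⟨i, rfl⟩
  exact GrSub.structMap_mem _ _ (GrSub.mem_generated d (freeGen d) i.1)

/-- The morphism out of a free persistence module given by the images of its generators. -/
noncomputable def freeDesc {n : ℕ} (d : Fin n → Deg r) (m : ∀ i, M.obj (d i)) :
    freeMod K d ⟶ M where
  app a := ModuleCat.ofHom
    (Finsupp.linearCombination K fun i : {i : Fin n // d i ≤ a} => M.structMap i.2 (m i.1))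
  naturality a b f := by
    refine ModuleCat.hom_ext <| Finsupp.lhom_ext fun i c => ?_
    change Finsupp.linearCombination K (fun i : {i : Fin n // d i ≤ b} => M.structMap i.2 (m i.1))
      (Finsupp.mapDomain _ (Finsupp.single i c)) = M.structMap (leOfHom f)
        (Finsupp.linearCombination K (fun i : {i : Fin n // d i ≤ a} => M.structMap i.2 (m i.1))
          (Finsupp.single i c))
    simp only [Finsupp.mapDomain_single, Finsupp.linearCombination_single, map_smul,
      structMap_structMap]

theorem freeDesc_freeGen {n : ℕ} (d : Fin n → Deg r) (m : ∀ i, M.obj (d i)) (i : Fin n) :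
    (freeDesc d m).app (d i) (freeGen d i) = m i :=
  (Finsupp.linearCombination_single K 1 _).trans ((one_smul _ _).trans (structMap_self M _))

theorem map_top_eq_generated {n : ℕ} {d : Fin n → Deg r} (p : freeMod K d ⟶ M) :
    (⊤ : GrSub (freeMod K d)).map p = GrSub.generated M d fun i => p.app (d i) (freeGen d i) := by
  rw [← generated_freeGen, GrSub.map_generated]

theorem map_freeDesc_top {n : ℕ} (d : Fin n → Deg r) (m : ∀ i, M.obj (d i)) :
    (⊤ : GrSub (freeMod K d)).map (freeDesc d m) = GrSub.generated M d m := by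
  rw [map_top_eq_generated]
  simp only [freeDesc_freeGen]

theorem exists_surjective_freeMod_iff {n : ℕ} {d : Fin n → Deg r} :
    (∃ p : freeMod K d ⟶ M, ∀ a, Function.Surjective (p.app a)) ↔
      ∃ m, GrSub.generated M d m = ⊤ := by
  constructor
  · rintro ⟨p, hp⟩
    exact ⟨_, (map_top_eq_generated p).symm.trans (GrSub.map_top_eq_top_iff.2 hp)⟩
  · rintro ⟨m, hm⟩
    exact ⟨freeDesc d m, GrSub.map_top_eq_top_iff.1 ((map_freeDesc_top d m).trans hm)⟩

theorem betti₀_le {n : ℕ} {d : Fin n → Deg r} (p : freeMod K d ⟶ M)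
    (hp : ∀ a, Function.Surjective (p.app a)) : betti₀ M ≤ n :=
  Nat.sInf_le ⟨d, p, hp⟩

theorem IsTame.exists_generated_eq_top (hM : IsTame M) :
    ∃ (d : Fin (betti₀ M) → Deg r) (m : ∀ i, M.obj (d i)), GrSub.generated M d m = ⊤ := by
  obtain ⟨_, n, _, d, _, p, h⟩ := hM
  obtain ⟨d, hd⟩ := Nat.sInf_mem (s := {n | ∃ (d : Fin n → Deg r) (p : freeMod K d ⟶ M),
    ∀ a, Function.Surjective (p.app a)}) ⟨n, d, p, fun a => (h a).2⟩
  exact ⟨d, exists_surjective_freeMod_iff.1 hd⟩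

/-! ### Kernels and cokernels -/

theorem app_exact {S : ShortComplex (PersMod K r)} (hS : S.Exact) (a : Deg r) :
    Function.Exact (S.f.app a) (S.g.app a) :=
  (ShortComplex.ShortExact.moduleCat_exact_iff_function_exact
    (S.map ((evaluation (Deg r) (ModuleCat.{u} K)).obj a))).1 (hS.map _)

theorem app_injective (f : M ⟶ N) [Mono f] (a : Deg r) : Function.Injective (f.app a) :=
  (ModuleCat.mono_iff_injective _).1 inferInstance

theorem app_surjective (f : M ⟶ N) [Epi f] (a : Deg r) : Function.Surjective (f.app a) :=
  (ModuleCat.epi_iff_surjective _).1 inferInstance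

theorem kernel_ι_app_exact (f : M ⟶ N) (a : Deg r) :
    Function.Exact ((Limits.kernel.ι f).app a) (f.app a) :=
  app_exact (ShortComplex.exact_kernel f) a

theorem cokernel_π_app_exact (f : M ⟶ N) (a : Deg r) :
    Function.Exact (f.app a) ((Limits.cokernel.π f).app a) :=
  app_exact (ShortComplex.exact_cokernel f) a

/-! ### Modules that are constant on the cells of a finite grid -/

/-- The coordinates of the points of `A` cut the space of degrees into half-open cells;
`gridFloor A a` is the smallest point of the cell of `a`, so that `a` and `b` lie in the same cell
when `gridFloor A a = gridFloor A b`. -/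
noncomputable def gridFloor (A : Finset (Deg r)) (a : Deg r) : Deg r :=
  fun i => (A.filter fun s => s i ≤ a i).sup fun s => s i

section gridFloor

variable {A B : Finset (Deg r)}

theorem gridFloor_le (A : Finset (Deg r)) (a : Deg r) : gridFloor A a ≤ a :=
  fun _ => Finset.sup_le fun _ hs => (Finset.mem_filter.1 hs).2

theorem gridFloor_mono (A : Finset (Deg r)) : Monotone (gridFloor A) :=
  fun _ _ h i => Finset.sup_mono <| Finset.monotone_filter_right A fun _ _ hs => hs.trans (h i)

theorem le_gridFloor_apply_iff {s : Deg r} (hs : s ∈ A) (a : Deg r) (i : Fin r) :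
    s i ≤ gridFloor A a i ↔ s i ≤ a i :=
  ⟨fun h => h.trans (gridFloor_le A a i), fun h =>
    Finset.le_sup (f := fun s : Deg r => s i) (Finset.mem_filter.2 ⟨hs, h⟩)⟩

theorem gridFloor_eq_gridFloor_iff {a b : Deg r} :
    gridFloor A a = gridFloor A b ↔ ∀ s ∈ A, ∀ i, s i ≤ a i ↔ s i ≤ b i := by
  refine ⟨fun h s hs i => ?_, fun h => funext fun i => ?_⟩
  · rw [← le_gridFloor_apply_iff hs, h, le_gridFloor_apply_iff hs]
  · exact congrArg (Finset.sup · fun s : Deg r => s i) (Finset.filter_congr fun s hs => h s hs i)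

theorem gridFloor_gridFloor (A : Finset (Deg r)) (a : Deg r) :
    gridFloor A (gridFloor A a) = gridFloor A a :=
  gridFloor_eq_gridFloor_iff.2 fun _ hs => le_gridFloor_apply_iff hs a

theorem finite_range_gridFloor (A : Finset (Deg r)) : (Set.range (gridFloor A)).Finite := by
  let corner (B : Fin r → A.powerset) : Deg r := fun i => (B i).1.sup fun s => s i
  refine (Set.finite_range corner).subset ?_
  rintro _ ⟨a, rfl⟩
  exact ⟨fun i => ⟨_, Finset.mem_powerset.2 (Finset.filter_subset _ A)⟩, rfl⟩

theorem exists_lt_gridFloor_eq (A : Finset (Deg r)) (b : Deg r) :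
    ∃ c : Deg r, (∀ i, b i < c i) ∧ gridFloor A c = gridFloor A b := by
  have gap (i : Fin r) : ∃ x > b i, ∀ s ∈ A, b i < s i → x < s i := by
    have below : ∀ᶠ x in 𝓝[>] b i, ∀ s ∈ A, b i < s i → x < s i :=
      A.eventually_all.2 fun s _ => Filter.eventually_imp_distrib_left.2 fun hs =>
        nhdsWithin_le_nhds (eventually_lt_nhds hs)
    exact (eventually_mem_nhdsWithin.and below).exists
  choose c hbc hc using gap
  refine ⟨c, hbc, gridFloor_eq_gridFloor_iff.2 fun s hs i => ⟨fun h => ?_, fun h => ?_⟩⟩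
  · exact not_lt.1 fun hlt => (hc i s hs hlt).not_ge h
  · exact h.trans (hbc i).le

end gridFloor

/-- The structure maps of `M` inside each cell of the grid spanned by `A` are isomorphisms. -/
def GridConst (A : Finset (Deg r)) (M : PersMod K r) : Prop :=
  ∀ (a b : Deg r) (h : a ≤ b), gridFloor A a = gridFloor A b → Function.Bijective (M.structMap h)

namespace GridConst

variable {A B : Finset (Deg r)}

theorem mono (hM : GridConst A M) (h : A ⊆ B) : GridConst B M :=
  fun a b hab hcell => hM a b hab <| gridFloor_eq_gridFloor_iff.2 fun s hs =>
    gridFloor_eq_gridFloor_iff.1 hcell s (h hs)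

theorem exists_structMap_gridFloor_eq (hM : GridConst A M) {a : Deg r} (x : M.obj a) :
    ∃ y, M.structMap (gridFloor_le A a) y = x :=
  (hM _ a (gridFloor_le A a) (gridFloor_gridFloor A a)).2 x

theorem freeMod {n : ℕ} {d : Fin n → Deg r} (hd : ∀ i, d i ∈ A) :
    GridConst A (freeMod K d) := by
  intro a b h hcell
  let e : {i : Fin n // d i ≤ a} ≃ {i : Fin n // d i ≤ b} :=
    Equiv.subtypeEquivRight fun i => forall_congr' (gridFloor_eq_gridFloor_iff.1 hcell _ (hd i))
  have he : ⇑((_root_.freeMod K d).structMap h) = Finsupp.domLCongr (R := K) (M := K) e :=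
    funext fun x => (Finsupp.equivMapDomain_eq_mapDomain e x).symm
  rw [he]
  exact (Finsupp.domLCongr e).bijective

theorem of_exact_right {f : L ⟶ M} {g : M ⟶ N} (hL : GridConst A L) (hM : GridConst A M)
    (hfg : ∀ a, Function.Exact (f.app a) (g.app a)) (hg : ∀ a, Function.Surjective (g.app a)) :
    GridConst A N :=
  fun a b h hcell => LinearMap.bijective_of_surjective_of_bijective_of_right_exact
    (f.app a).hom (g.app a).hom (f.app b).hom (g.app b).hom _ _ _
    (LinearMap.ext fun x => app_structMap f h x)
    (LinearMap.ext fun x => app_structMap g h x)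
    (hfg a) (hfg b) (hL a b h hcell).2 (hM a b h hcell) (hg a) (hg b)

theorem of_exact_left {f : L ⟶ M} {g : M ⟶ N} (hM : GridConst A M) (hN : GridConst A N)
    (hfg : ∀ a, Function.Exact (f.app a) (g.app a)) (hf : ∀ a, Function.Injective (f.app a)) :
    GridConst A L :=
  fun a b h hcell => LinearMap.bijective_of_bijective_of_injective_of_left_exact
    (f.app a).hom (g.app a).hom (f.app b).hom (g.app b).hom _ _ _
    (LinearMap.ext fun x => app_structMap f h x)
    (LinearMap.ext fun x => app_structMap g h x)
    (hfg a) (hfg b) (hM a b h hcell) (hN a b h hcell).1 (hf a) (hf b)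

theorem kernel (hM : GridConst A M) (hN : GridConst A N) (f : M ⟶ N) :
    GridConst A (Limits.kernel f) :=
  hM.of_exact_left hN (kernel_ι_app_exact f) (app_injective (Limits.kernel.ι f))

theorem cokernel (hM : GridConst A M) (hN : GridConst A N) (f : M ⟶ N) :
    GridConst A (Limits.cokernel f) :=
  hM.of_exact_right hN (cokernel_π_app_exact f) (app_surjective (Limits.cokernel.π f))

theorem exists_generated_eq_top (hM : GridConst A M) (hfin : ∀ a, Module.Finite K (M.obj a)) :
    ∃ (n : ℕ) (d : Fin n → Deg r) (m : ∀ i, M.obj (d i)), GrSub.generated M d m = ⊤ := by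
  choose G hG using fun a => (hfin a).fg_top
  have hfinite : (⋃ a ∈ Set.range (gridFloor A), Sigma.mk a '' (G a : Set (M.obj a))).Finite :=
    (finite_range_gridFloor A).biUnion fun a _ => (G a).finite_toSet.image _
  obtain ⟨n, x, -, hx⟩ := hfinite.fin_param
  refine ⟨n, fun i => (x i).1, fun i => (x i).2, top_le_iff.1 fun a y _ => ?_⟩
  set S := GrSub.generated M (fun i => (x i).1) fun i => (x i).2
  obtain ⟨y, rfl⟩ := hM.exists_structMap_gridFloor_eq y
  have span_le : Submodule.span K (G (gridFloor A a)) ≤ S.comp (gridFloor A a) := by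
    refine Submodule.span_le.2 fun z hz => ?_
    obtain ⟨i, hi⟩ : (⟨_, z⟩ : Σ a, M.obj a) ∈ Set.range x :=
      hx ▸ Set.mem_biUnion ⟨a, rfl⟩ ⟨z, hz, rfl⟩
    have hmem := GrSub.mem_generated (fun i => (x i).1) (fun i => (x i).2) i
    rwa [hi] at hmem
  exact S.structMap_mem _ (span_le (hG (gridFloor A a) ▸ Submodule.mem_top))

theorem exists_generated_gridFloor_le (hM : GridConst A M) {k : ℕ} (d : Fin k → Deg r)
    (m : ∀ i, M.obj (d i)) : ∃ m' : ∀ i, M.obj (gridFloor A (d i)),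
      GrSub.generated M d m ≤ GrSub.generated M (fun i => gridFloor A (d i)) m' := by
  choose m' hm' using fun i => hM.exists_structMap_gridFloor_eq (m i)
  refine ⟨m', GrSub.generated_le_iff.2 fun i => ?_⟩
  rw [← hm' i]
  exact GrSub.structMap_mem _ _ (GrSub.mem_generated _ m' i)

theorem structMap_mem_generated_iff (hM : GridConst A M) {k : ℕ} {d : Fin k → Deg r}
    (hd : ∀ i, gridFloor A (d i) = d i) (m : ∀ i, M.obj (d i)) {a b : Deg r} (h : a ≤ b)
    (hcell : gridFloor A a = gridFloor A b) {x : M.obj a} :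
    M.structMap h x ∈ (GrSub.generated M d m).comp b ↔ x ∈ (GrSub.generated M d m).comp a := by
  refine ⟨fun hx => ?_, GrSub.structMap_mem _ h⟩
  have comp_le : (GrSub.generated M d m).comp b ≤
      ((GrSub.generated M d m).comp a).map (M.structMap h) := by
    refine Submodule.span_le.2 ?_
    rintro _ ⟨i, f, rfl⟩
    have hia : d i ≤ a := calc
      d i = gridFloor A (d i) := (hd i).symm
      _ ≤ gridFloor A b := gridFloor_mono A (leOfHom f)
      _ = gridFloor A a := hcell.symm
      _ ≤ a := gridFloor_le A a
    exact ⟨_, Submodule.subset_span ⟨i, homOfLE hia, rfl⟩, structMap_structMap M hia h (m i)⟩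
  obtain ⟨y, hy, hyx⟩ := comp_le hx
  rwa [← (hM a b h hcell).1 hyx]

end GridConst

/-! ### Tame modules -/

instance {n : ℕ} (d : Fin n → Deg r) (a : Deg r) :
    Module.Finite K ((freeMod K d).obj a) :=
  inferInstanceAs (Module.Finite K ({i : Fin n // d i ≤ a} →₀ K))

instance (f : M ⟶ N) (a : Deg r) [Module.Finite K (M.obj a)] :
    Module.Finite K ((Limits.kernel f).obj a) :=
  Module.Finite.of_injective ((Limits.kernel.ι f).app a).hom (app_injective (Limits.kernel.ι f) a)

instance (f : M ⟶ N) (a : Deg r) [Module.Finite K (N.obj a)] :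
    Module.Finite K ((Limits.cokernel f).obj a) :=
  Module.Finite.of_surjective ((Limits.cokernel.π f).app a).hom
    (app_surjective (Limits.cokernel.π f) a)

theorem isTame_of_gridConst {A : Finset (Deg r)} (hM : GridConst A M)
    (hfin : ∀ a, Module.Finite K (M.obj a)) : IsTame M := by
  classical
  obtain ⟨n, d, hd⟩ := hM.exists_generated_eq_top hfin
  obtain ⟨p, hp⟩ := exists_surjective_freeMod_iff.2 hd
  have hker : GridConst (A ∪ Finset.univ.image d) (Limits.kernel p) :=
    (GridConst.freeMod fun i => by simp).kernel (hM.mono Finset.subset_union_left) p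
  obtain ⟨l, e, he⟩ := hker.exists_generated_eq_top fun _ => inferInstance
  obtain ⟨q, hq⟩ := exists_surjective_freeMod_iff.2 he
  refine ⟨l, n, e, d, q ≫ Limits.kernel.ι p, p, fun a => ⟨fun y => ?_, hp a⟩⟩
  exact (kernel_ι_app_exact p a y).trans (hq a).exists

theorem isTame_iff_gridConst :
    IsTame M ↔ (∃ A, GridConst A M) ∧ ∀ a, Module.Finite K (M.obj a) := by
  classical
  refine ⟨?_, fun ⟨⟨_, hM⟩, hfin⟩ => isTame_of_gridConst hM hfin⟩
  rintro ⟨m, n, e, d, q, p, h⟩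
  refine ⟨⟨Finset.univ.image e ∪ Finset.univ.image d, ?_⟩, fun a => ?_⟩
  · exact (GridConst.freeMod fun i => by simp).of_exact_right (GridConst.freeMod fun i => by simp)
      (fun a => (h a).1) fun a => (h a).2
  · exact Module.Finite.of_surjective (p.app a).hom (h a).2

theorem isTame_freeMod {n : ℕ} (d : Fin n → Deg r) : IsTame (freeMod K d) := by
  classical
  exact isTame_of_gridConst (A := Finset.univ.image d) (GridConst.freeMod fun i => by simp)
    fun _ => inferInstance

theorem exists_common_gridConst (hM : IsTame M) (hN : IsTame N) :
    ∃ A, GridConst A M ∧ GridConst A N := by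
  classical
  obtain ⟨⟨A, hA⟩, -⟩ := isTame_iff_gridConst.1 hM
  obtain ⟨⟨B, hB⟩, -⟩ := isTame_iff_gridConst.1 hN
  exact ⟨A ∪ B, hA.mono Finset.subset_union_left, hB.mono Finset.subset_union_right⟩

theorem IsTame.kernel (hM : IsTame M) (hN : IsTame N) (f : M ⟶ N) :
    IsTame (Limits.kernel f) := by
  obtain ⟨A, hAM, hAN⟩ := exists_common_gridConst hM hN
  have := (isTame_iff_gridConst.1 hM).2
  exact isTame_of_gridConst (hAM.kernel hAN f) fun _ => inferInstance

theorem IsTame.cokernel (hM : IsTame M) (hN : IsTame N) (f : M ⟶ N) :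
    IsTame (Limits.cokernel f) := by
  obtain ⟨A, hAM, hAN⟩ := exists_common_gridConst hM hN
  have := (isTame_iff_gridConst.1 hN).2
  exact isTame_of_gridConst (hAM.cokernel hAN f) fun _ => inferInstance

/-! ### Thickenings of graded submodules -/

/-- The thickening of a graded submodule `S` by a contour `C` at `ε`: the elements `x` of degree `a`
whose image in degree `C(a, ε)` lies in `S`, and all elements of degree `a` if `C(a, ε) = ∞`. The
condition is imposed in every degree above `C(a, ε)`, which amounts to the same. -/
noncomputable def Contour.thicken (C : Contour r) (ε : ℝ≥0) (S : GrSub M) : GrSub M where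
  comp a := ⨅ (b : Deg r) (h : a ≤ b) (_ : C.toFun a ε ≤ b), (S.comp b).comap (M.structMap h)
  map_mem {a b} f x hx := by
    simp only [Submodule.mem_iInf, Submodule.mem_comap] at hx ⊢
    intro c hbc hc
    have hac := hx c ((leOfHom f).trans hbc)
      ((C.mono (WithTop.coe_le_coe.2 (leOfHom f)) le_rfl).trans hc)
    rwa [← structMap_structMap M (leOfHom f) hbc] at hac

namespace Contour

variable {C : Contour r} {ε τ : ℝ≥0}

theorem eq_top_or_exists_le (C : Contour r) (ε : ℝ≥0) (a : Deg r) :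
    C.toFun a ε = ⊤ ∨ ∃ b, a ≤ b ∧ C.toFun a ε = (b : WithTop (Deg r)) := by
  refine or_iff_not_imp_left.2 fun htop => ?_
  obtain ⟨b, hb⟩ := WithTop.ne_top_iff_exists.1 htop
  exact ⟨b, WithTop.coe_le_coe.1 (hb ▸ C.le a ε), hb.symm⟩

theorem mem_thicken {S : GrSub M} {a : Deg r} {x : M.obj a} :
    x ∈ (C.thicken ε S).comp a ↔
      ∀ (b : Deg r) (h : a ≤ b), C.toFun a ε ≤ b → M.structMap h x ∈ S.comp b := by
  simp only [thicken, Submodule.mem_iInf, Submodule.mem_comap]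

theorem mem_thicken_iff_of_eq {S : GrSub M} {a b : Deg r} {x : M.obj a} (h : a ≤ b)
    (hb : C.toFun a ε = b) :
    x ∈ (C.thicken ε S).comp a ↔ M.structMap h x ∈ S.comp b := by
  refine mem_thicken.trans ⟨fun hx => hx b h hb.le, fun hx c hac hc => ?_⟩
  have hbc : b ≤ c := WithTop.coe_le_coe.1 (hb ▸ hc)
  rw [← structMap_structMap M h hbc]
  exact S.structMap_mem hbc hx

theorem mem_thicken_of_eq_top (S : GrSub M) {a : Deg r} (ha : C.toFun a ε = ⊤) (x : M.obj a) :
    x ∈ (C.thicken ε S).comp a :=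
  mem_thicken.2 fun b _ hb => (WithTop.not_top_le_coe b (ha ▸ hb)).elim

theorem thicken_mono {S T : GrSub M} (hε : ε ≤ τ) (h : S ≤ T) : C.thicken ε S ≤ C.thicken τ T :=
  fun _ _ hx => mem_thicken.2 fun b hab hb =>
    h b (mem_thicken.1 hx b hab ((C.mono le_rfl hε).trans hb))

theorem le_thicken (C : Contour r) (ε : ℝ≥0) (S : GrSub M) : S ≤ C.thicken ε S :=
  fun _ _ hx => mem_thicken.2 fun _ h _ => S.structMap_mem h hx

theorem thicken_thicken_le (C : Contour r) (ε τ : ℝ≥0) (S : GrSub M) :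
    C.thicken ε (C.thicken τ S) ≤ C.thicken (ε + τ) S := by
  refine fun a x hx => mem_thicken.2 fun c hac hc => ?_
  have hlax : C.toFun (C.toFun a ε) τ ≤ c := (C.lax a ε τ).trans hc
  obtain ⟨b, hb, hbc⟩ := WithTop.le_coe_iff.1 ((C.le (C.toFun a ε) τ).trans hlax)
  have hab : a ≤ b := WithTop.coe_le_coe.1 (hb ▸ C.le a ε)
  rw [← structMap_structMap M hab hbc]
  exact mem_thicken.1 (mem_thicken.1 hx b hab hb.le) c hbc (hb ▸ hlax)

theorem comap_thicken (f : M ⟶ N) (S : GrSub N) :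
    (C.thicken ε S).comap f = C.thicken ε (S.comap f) := by
  refine GrSub.ext <| funext fun a => Submodule.ext fun x => ?_
  refine mem_thicken.trans (Iff.trans ?_ mem_thicken.symm)
  simp only [← app_structMap]
  rfl

theorem mem_noise_iff : M ∈ C.noise K ε ↔ IsTame M ∧ C.thicken ε (⊥ : GrSub M) = ⊤ := by
  refine and_congr_right fun _ => ?_
  simp only [map_eq_zero_iff_structMap]
  refine ⟨fun h => top_le_iff.1 fun a x _ => ?_, fun h a b hab hb x => ?_⟩
  · obtain ha | ⟨b, hab, hb⟩ := C.eq_top_or_exists_le ε a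
    · exact mem_thicken_of_eq_top ⊥ ha x
    · exact (mem_thicken_iff_of_eq hab hb).2 (h a b hab hb x)
  · exact (mem_thicken_iff_of_eq hab hb).1 (h ▸ Submodule.mem_top : x ∈ (C.thicken ε ⊥).comp a)

theorem kernel_mem_noise_iff (hM : IsTame M) (hN : IsTame N) {f : M ⟶ N} :
    Limits.kernel f ∈ C.noise K ε ↔ (⊥ : GrSub N).comap f ≤ C.thicken ε ⊥ := by
  rw [mem_noise_iff, and_iff_right (hM.kernel hN f),
    ← GrSub.comap_bot_eq_bot_of_injective (app_injective (Limits.kernel.ι f)), ← comap_thicken,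
    GrSub.comap_bot_eq_map_top (kernel_ι_app_exact f), GrSub.map_le_iff_le_comap, top_le_iff]

theorem cokernel_mem_noise_iff (hM : IsTame M) (hN : IsTame N) {f : M ⟶ N} :
    Limits.cokernel f ∈ C.noise K ε ↔ C.thicken ε ((⊤ : GrSub M).map f) = ⊤ := by
  rw [mem_noise_iff, and_iff_right (hM.cokernel hN f),
    ← GrSub.comap_eq_top_iff_of_surjective (app_surjective (Limits.cokernel.π f)), comap_thicken,
    GrSub.comap_bot_eq_map_top (cokernel_π_app_exact f)]

theorem comap_map_le_thicken {f : M ⟶ N} (hf : (⊥ : GrSub N).comap f ≤ C.thicken ε ⊥)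
    (S : GrSub M) : (S.map f).comap f ≤ C.thicken ε S := by
  rintro a x ⟨y, hy, hyx : f.app a y = f.app a x⟩
  have hker : x - y ∈ ((⊥ : GrSub N).comap f).comp a := by
    change f.app a (x - y) = 0
    rw [map_sub, hyx, sub_self]
  rw [← sub_add_cancel x y]
  exact add_mem (thicken_mono le_rfl bot_le a (hf a hker)) (C.le_thicken ε S a hy)

theorem exists_forall_mem_thicken_map {f : M ⟶ L} {a : Deg r} {x : L.obj a}
    (hx : x ∈ (C.thicken ε ((⊤ : GrSub M).map f)).comp a) :
    ∃ (b : Deg r) (y : M.obj b), ∀ S : GrSub M, y ∈ S.comp b →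
      x ∈ (C.thicken ε (S.map f)).comp a := by
  obtain ha | ⟨b, hab, hb⟩ := C.eq_top_or_exists_le ε a
  · exact ⟨a, 0, fun S _ => mem_thicken_of_eq_top _ ha x⟩
  · obtain ⟨y, -, hy⟩ := (mem_thicken_iff_of_eq hab hb).1 hx
    exact ⟨b, y, fun S hyS => (mem_thicken_iff_of_eq hab hb).2 ⟨y, hyS, hy⟩⟩

theorem exists_generated_le_thicken_map {f : M ⟶ L}
    (hf : C.thicken ε ((⊤ : GrSub M).map f) = ⊤) {k : ℕ} (d : Fin k → Deg r)
    (l : ∀ i, L.obj (d i)) :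
    ∃ (e : Fin k → Deg r) (m : ∀ i, M.obj (e i)),
      GrSub.generated L d l ≤ C.thicken ε ((GrSub.generated M e m).map f) := by
  choose e m hm using fun i => exists_forall_mem_thicken_map (C := C) (ε := ε) (f := f)
    (x := l i) (hf ▸ Submodule.mem_top)
  exact ⟨e, m, GrSub.generated_le_iff.2 fun i => hm i _ (GrSub.mem_generated e m i)⟩

end Contour

theorem NoiseClose.exists_thicken_generated_eq_top {C : Contour r} {ε : ℝ≥0} {M N : TameMod K r}
    (h : NoiseClose (C.noise K) ε M N) :
    ∃ (d : Fin (betti₀ N.1) → Deg r) (m : ∀ i, M.1.obj (d i)),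
      C.thicken ε (GrSub.generated M.1 d m) = ⊤ := by
  obtain ⟨L, f, g, ε₁, ε₂, ⟨τ, μ, hε₁, hkerf, hcokerf⟩, ⟨τ', μ', hε₂, -, hcokerg⟩, hε⟩ := h
  rw [Contour.kernel_mem_noise_iff M.2 L.2] at hkerf
  rw [Contour.cokernel_mem_noise_iff M.2 L.2] at hcokerf
  rw [Contour.cokernel_mem_noise_iff N.2 L.2] at hcokerg
  obtain ⟨e, n, hn⟩ := N.2.exists_generated_eq_top
  rw [← hn, GrSub.map_generated] at hcokerg
  obtain ⟨d, m, hm⟩ := Contour.exists_generated_le_thicken_map hcokerf e fun i => g.app (e i) (n i)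
  set S := GrSub.generated M.1 d m
  have hsum : μ' + μ + τ ≤ ε := calc
    μ' + μ + τ = τ + μ + μ' := by ring
    _ ≤ τ + μ + (τ' + μ') := by gcongr; exact le_add_self
    _ ≤ ε := (add_le_add hε₁ hε₂).trans hε
  have thicken_map_eq_top : C.thicken (μ' + μ) (S.map f) = ⊤ := top_le_iff.1 <| calc
    ⊤ = C.thicken μ' (GrSub.generated L.1 e fun i => g.app (e i) (n i)) := hcokerg.symm
    _ ≤ C.thicken μ' (C.thicken μ (S.map f)) := Contour.thicken_mono le_rfl hm
    _ ≤ C.thicken (μ' + μ) (S.map f) := C.thicken_thicken_le μ' μ _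
  refine ⟨d, m, top_le_iff.1 ?_⟩
  calc (⊤ : GrSub M.1) = (C.thicken (μ' + μ) (S.map f)).comap f := by rw [thicken_map_eq_top]; rfl
    _ = C.thicken (μ' + μ) ((S.map f).comap f) := Contour.comap_thicken f _
    _ ≤ C.thicken (μ' + μ) (C.thicken τ S) :=
      Contour.thicken_mono le_rfl (Contour.comap_map_le_thicken hkerf S)
    _ ≤ C.thicken (μ' + μ + τ) S := C.thicken_thicken_le _ _ _
    _ ≤ C.thicken ε S := Contour.thicken_mono hsum le_rfl

/-- The shift-dimension of `M` with respect to a contour: the smallest number of homogeneous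
elements of `M` whose span thickens to all of `M` at `ε`. -/
noncomputable def contourDim (C : Contour r) (ε : ℝ≥0) (M : PersMod K r) : ℕ :=
  sInf {k | ∃ (d : Fin k → Deg r) (m : ∀ i, M.obj (d i)),
    C.thicken ε (GrSub.generated M d m) = ⊤}

theorem contourDim_le {C : Contour r} {ε : ℝ≥0} {k : ℕ} {d : Fin k → Deg r}
    {m : ∀ i, M.obj (d i)} (h : C.thicken ε (GrSub.generated M d m) = ⊤) :
    contourDim C ε M ≤ k :=
  Nat.sInf_le ⟨d, m, h⟩

theorem IsTame.exists_thicken_generated_eq_top (hM : IsTame M) (C : Contour r) (ε : ℝ≥0) :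
    ∃ (d : Fin (contourDim C ε M) → Deg r) (m : ∀ i, M.obj (d i)),
      C.thicken ε (GrSub.generated M d m) = ⊤ := by
  refine Nat.sInf_mem (s := {k | ∃ (d : Fin k → Deg r) (m : ∀ i, M.obj (d i)),
    C.thicken ε (GrSub.generated M d m) = ⊤}) ?_
  obtain ⟨d, m, hm⟩ := hM.exists_generated_eq_top
  exact ⟨_, d, m, top_le_iff.1 (hm ▸ C.le_thicken ε _)⟩

theorem noiseEquivalence_of_mono (C : Contour r) {ε : ℝ≥0} (hM : IsTame M) (hN : IsTame N)
    {f : M ⟶ N} [Mono f] (h : C.thicken ε ((⊤ : GrSub M).map f) = ⊤) :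
    NoiseEquivalence (C.noise K) ε f := by
  refine ⟨0, ε, (zero_add ε).le, (Contour.kernel_mem_noise_iff hM hN).2 ?_,
    (Contour.cokernel_mem_noise_iff hM hN).2 h⟩
  rw [GrSub.comap_bot_eq_bot_of_injective (app_injective f)]
  exact bot_le

theorem noiseClose_of_mono (C : Contour r) {ε : ℝ≥0} {M N : TameMod K r}
    {f : N.1 ⟶ M.1} [Mono f] (h : C.thicken ε ((⊤ : GrSub N.1).map f) = ⊤) :
    NoiseClose (C.noise K) ε M N := by
  refine ⟨M, 𝟙 M.1, f, 0, ε, noiseEquivalence_of_mono C M.2 M.2 (top_le_iff.1 ?_),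
    noiseEquivalence_of_mono C N.2 M.2 h, (zero_add ε).le⟩
  exact (GrSub.map_top_eq_top_iff.2 (app_surjective (𝟙 M.1))).ge.trans (C.le_thicken 0 _)

theorem exists_noiseClose (M : TameMod K r) {C : Contour r} {ε : ℝ≥0} {k : ℕ} {d : Fin k → Deg r}
    {m : ∀ i, M.1.obj (d i)} (h : C.thicken ε (GrSub.generated M.1 d m) = ⊤) :
    ∃ N : TameMod K r, NoiseClose (C.noise K) ε M N ∧ betti₀ N.1 ≤ k := by
  have hF : IsTame (freeMod K d) := isTame_freeMod d
  let p : freeMod K d ⟶ M.1 := freeDesc d m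
  let N : TameMod K r := ⟨Abelian.image p, M.2.kernel (hF.cokernel M.2 p) _⟩
  refine ⟨N, noiseClose_of_mono C (f := Abelian.image.ι p) ?_,
    betti₀_le (Abelian.factorThruImage p) (app_surjective _)⟩
  have range_eq : (⊤ : GrSub N.1).map (Abelian.image.ι p) = GrSub.generated M.1 d m := by
    rw [← map_freeDesc_top, ← GrSub.map_top_eq_top_iff.2
      (app_surjective (Abelian.factorThruImage p)), GrSub.map_map, Abelian.image.fac]
  rwa [range_eq]

/-! ### Right continuous contours -/

/-- Right continuity of a contour in `ε`, wherever its value is finite. It is stated in terms of the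
order: `C(a, ε)` is eventually below every `c` that is larger than `C(a, δ)` in each coordinate. -/
def Contour.RightContinuous (C : Contour r) : Prop :=
  ∀ (a b : Deg r) (δ : ℝ≥0), C.toFun a δ = b → ∀ c : Deg r, (∀ i, b i < c i) →
    ∀ᶠ ε in 𝓝[>] δ, C.toFun a ε ≤ c

theorem Deg.exists_lt_and_not_le {α b c : Deg r} (hα : ¬ α ≤ b) (hbc : ∀ i, b i < c i) :
    ∃ c' ≤ c, (∀ i, b i < c' i) ∧ ¬ α ≤ c' := by
  obtain ⟨i, hi⟩ : ∃ i, ¬ α i ≤ b i := not_forall.1 hα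
  obtain ⟨y, hby, hy⟩ := exists_between (lt_min (hbc i) (not_le.1 hi))
  obtain ⟨hyc, hyα⟩ := lt_min_iff.1 hy
  have lt_update : ∀ j, b j < Function.update c i y j :=
    (Function.forall_update_iff c fun j z => b j < z).2 ⟨hby, fun j _ => hbc j⟩
  refine ⟨Function.update c i y, update_le_self_iff.2 hyc.le, lt_update, fun h => hyα.not_ge ?_⟩
  exact (h i).trans_eq (Function.update_self i y c)

namespace Contour

theorem truncate_of_le {C : Contour r} {α : Deg r} {x : WithTop (Deg r)} {ε : ℝ≥0}
    (h : α ≤ C.toFun x ε) : (C.truncate α).toFun x ε = ⊤ :=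
  if_neg (not_not_intro h)

theorem truncate_of_not_le {C : Contour r} {α : Deg r} {x : WithTop (Deg r)} {ε : ℝ≥0}
    (h : ¬ α ≤ C.toFun x ε) : (C.truncate α).toFun x ε = C.toFun x ε :=
  if_pos h

end Contour

namespace Contour.RightContinuous

variable {C : Contour r} {δ : ℝ≥0}

theorem exists_gt_gridFloor_eq (hC : C.RightContinuous) (A : Finset (Deg r)) (δ : ℝ≥0) :
    ∃ ε > δ, ∀ t ∈ Set.range (gridFloor A), ∀ b : Deg r, C.toFun t δ = b →
      ∃ c : Deg r, b ≤ c ∧ gridFloor A b = gridFloor A c ∧ C.toFun t ε ≤ c := by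
  have eventually_same_cell : ∀ᶠ ε in 𝓝[>] δ, ∀ t ∈ Set.range (gridFloor A), ∀ b : Deg r,
      C.toFun t δ = b → ∃ c : Deg r, b ≤ c ∧ gridFloor A b = gridFloor A c ∧ C.toFun t ε ≤ c := by
    refine (Filter.eventually_all_finite (finite_range_gridFloor A)).2 fun t _ => ?_
    obtain ht | ⟨b, -, hb⟩ := C.eq_top_or_exists_le δ t
    · exact .of_forall fun ε b hb => (WithTop.top_ne_coe (ht.symm.trans hb)).elim
    · obtain ⟨c, hbc, hc⟩ := exists_lt_gridFloor_eq A b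
      filter_upwards [hC t b δ hb c hbc] with ε hε b' hb'
      obtain rfl : b = b' := WithTop.coe_injective (hb.symm.trans hb')
      exact ⟨c, fun i => (hbc i).le, hc.symm, hε⟩
  exact (eventually_mem_nhdsWithin.and eventually_same_cell).exists

theorem exists_thicken_generated_eq_top (hC : C.RightContinuous) {A : Finset (Deg r)}
    (hM : GridConst A M) {k : ℕ} (h : ∀ ε > δ, ∃ (d : Fin k → Deg r) (m : ∀ i, M.obj (d i)),
      C.thicken ε (GrSub.generated M d m) = ⊤) :
    ∃ (d : Fin k → Deg r) (m : ∀ i, M.obj (d i)), C.thicken δ (GrSub.generated M d m) = ⊤ := by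
  obtain ⟨ε, hδε, hcell⟩ := hC.exists_gt_gridFloor_eq A δ
  obtain ⟨d, m, hm⟩ := h ε hδε
  obtain ⟨m', hle⟩ := hM.exists_generated_gridFloor_le d m
  refine ⟨fun i => gridFloor A (d i), m', top_le_iff.1 fun a x _ => ?_⟩
  set S := GrSub.generated M (fun i => gridFloor A (d i)) m'
  have thicken_eq_top : C.thicken ε S = ⊤ := top_le_iff.1 (hm ▸ thicken_mono le_rfl hle)
  obtain ⟨y, rfl⟩ := hM.exists_structMap_gridFloor_eq x
  refine GrSub.structMap_mem _ _ ?_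
  obtain ht | ⟨b, htb, hb⟩ := C.eq_top_or_exists_le δ (gridFloor A a)
  · exact mem_thicken_of_eq_top S ht y
  · obtain ⟨c, hbc, hfloor, hc⟩ := hcell _ ⟨a, rfl⟩ b hb
    have hy : y ∈ (C.thicken ε S).comp (gridFloor A a) := thicken_eq_top ▸ Submodule.mem_top
    have hyc := mem_thicken.1 hy c (htb.trans hbc) hc
    rw [← structMap_structMap M htb hbc] at hyc
    exact (mem_thicken_iff_of_eq htb hb).2 <| (hM.structMap_mem_generated_iff
      (fun i => gridFloor_gridFloor A (d i)) m' hbc hfloor).1 hyc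

theorem contourDim_le_of_forall_gt (hC : C.RightContinuous) (hM : IsTame M) {k : ℕ}
    (h : ∀ ε > δ, ∃ (d : Fin k → Deg r) (m : ∀ i, M.obj (d i)),
      C.thicken ε (GrSub.generated M d m) = ⊤) :
    contourDim C δ M ≤ k := by
  obtain ⟨⟨A, hA⟩, -⟩ := isTame_iff_gridConst.1 hM
  obtain ⟨d, m, hm⟩ := hC.exists_thicken_generated_eq_top hA h
  exact contourDim_le hm

theorem truncate (hC : C.RightContinuous) (α : Deg r) : (C.truncate α).RightContinuous := by
  intro a b δ hb c hbc
  by_cases hα : α ≤ C.toFun a δ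
  · exact (WithTop.top_ne_coe ((truncate_of_le hα).symm.trans hb)).elim
  rw [truncate_of_not_le hα] at hb
  rw [hb, WithTop.coe_le_coe] at hα
  obtain ⟨c', hc'c, hbc', hαc'⟩ := Deg.exists_lt_and_not_le hα hbc
  filter_upwards [hC a b δ hb c' hbc'] with ε hε
  rw [truncate_of_not_le fun h => hαc' (WithTop.coe_le_coe.1 (h.trans hε))]
  exact hε.trans (WithTop.coe_le_coe.2 hc'c)

end Contour.RightContinuous

theorem rightContinuous_standardContour (v : Deg r) : (standardContour v).RightContinuous := by
  intro a b δ hb c hbc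
  obtain rfl : a + δ • v = b := WithTop.coe_injective hb
  have eventually_lt (i : Fin r) : ∀ᶠ ε in 𝓝 δ, a i + ε * v i < c i :=
    Continuous.tendsto (by fun_prop) δ |>.eventually_lt_const (hbc i)
  filter_upwards [nhdsWithin_le_nhds (Filter.eventually_all.2 eventually_lt)] with ε hε
  exact WithTop.coe_le_coe.2 fun i => (hε i).le

/-! ### Hierarchical stabilization -/

theorem noiseDist_le {V : ℝ≥0 → Set (PersMod K r)} {ε : ℝ≥0} {M N : TameMod K r}
    (h : NoiseClose V ε M N) : noiseDist V M N ≤ ε :=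
  iInf₂_le ε h

theorem NoiseClose.of_noiseDist_lt {V : ℝ≥0 → Set (PersMod K r)} {ε : ℝ≥0} {M N : TameMod K r}
    (h : noiseDist V M N < ε) : NoiseClose V ε M N := by
  simp only [noiseDist, iInf_lt_iff] at h
  obtain ⟨ε', ⟨L, f, g, ε₁, ε₂, hf, hg, hle⟩, hε'⟩ := h
  exact ⟨L, f, g, ε₁, ε₂, hf, hg, hle.trans (ENNReal.coe_lt_coe.1 hε').le⟩

theorem mainTheorem5_general {C : Contour r} (hC : C.RightContinuous) (M : TameMod K r) (δ : ℝ≥0) :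
    hierarchicalStabilization (noiseDist (C.noise K)) (fun N : TameMod K r => betti₀ N.1) M δ =
      contourDim C δ M.1 := by
  have le_betti₀ {N : TameMod K r} (hN : noiseDist (C.noise K) M N ≤ δ) :
      contourDim C δ M.1 ≤ betti₀ N.1 :=
    hC.contourDim_le_of_forall_gt M.2 fun ε hε => NoiseClose.exists_thicken_generated_eq_top <|
      .of_noiseDist_lt <| hN.trans_lt <| ENNReal.coe_lt_coe.2 hε
  obtain ⟨d, m, hm⟩ := M.2.exists_thicken_generated_eq_top C δ
  obtain ⟨N, hclose, hN⟩ := exists_noiseClose M hm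
  have hdist := noiseDist_le hclose
  refine IsLeast.csInf_eq ⟨⟨N, hdist, hN.antisymm (le_betti₀ hdist)⟩, ?_⟩
  rintro _ ⟨N', hN', rfl⟩
  exact le_betti₀ hN'

/-! ### Truncated standard contours -/

theorem thicken_truncate (C : Contour r) (α : Deg r) (ε : ℝ≥0) (S : GrSub M) :
    (C.truncate α).thicken ε S =
      (C.thicken ε (S.map (GrSub.above M α).mkQ)).comap (GrSub.above M α).mkQ := by
  rw [Contour.comap_thicken]
  refine GrSub.ext <| funext fun a => Submodule.ext fun x => ?_
  obtain htop | ⟨b, hab, hb⟩ := C.eq_top_or_exists_le ε a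
  · have htop' : (C.truncate α).toFun a ε = ⊤ := Contour.truncate_of_le (htop ▸ le_top)
    exact iff_of_true (Contour.mem_thicken_of_eq_top _ htop' x)
      (Contour.mem_thicken_of_eq_top _ htop x)
  rw [Contour.mem_thicken_iff_of_eq hab hb, GrSub.comap_map_mkQ_comp]
  by_cases hα : α ≤ b
  · have htop : (C.truncate α).toFun a ε = ⊤ :=
      Contour.truncate_of_le (hb ▸ WithTop.coe_le_coe.2 hα)
    rw [GrSub.above_comp_of_le hα, top_sup_eq]
    exact iff_of_true (Contour.mem_thicken_of_eq_top _ htop x) Submodule.mem_top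
  · have hb' : (C.truncate α).toFun a ε = b := by
      rwa [Contour.truncate_of_not_le]
      rwa [hb, WithTop.coe_le_coe]
    rw [Contour.mem_thicken_iff_of_eq hab hb', GrSub.above_comp_of_not_le hα, bot_sup_eq]

theorem contourDim_truncate (C : Contour r) (α : Deg r) (ε : ℝ≥0) (M : PersMod K r) :
    contourDim (C.truncate α) ε M = contourDim C ε (GrSub.above M α).quotient := by
  have hπ := (GrSub.above M α).mkQ_surjective
  refine congrArg sInf <| Set.ext fun k => exists_congr fun d => ?_
  refine Iff.trans (exists_congr fun m => ?_)
    (Function.Surjective.piMap fun i => hπ (d i)).exists.symm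
  rw [thicken_truncate, GrSub.comap_eq_top_iff_of_surjective hπ, GrSub.map_generated]
  rfl

theorem mem_thicken_standardContour {v : Deg r} {ε : ℝ≥0} {S : GrSub M} {a : Deg r} {x : M.obj a} :
    x ∈ ((standardContour v).thicken ε S).comp a ↔
      M.structMap (Deg.le_add a (ε • v)) x ∈ S.comp (a + ε • v) :=
  Contour.mem_thicken_iff_of_eq _ rfl

theorem shiftZero_iff_thicken_bot_eq_top {v : Deg r} {ε : ℝ≥0} :
    ShiftZero (ε • v) M ↔ (standardContour v).thicken ε (⊥ : GrSub M) = ⊤ := by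
  rw [← top_le_iff]
  refine forall_congr' fun a => ?_
  rw [map_eq_zero_iff_structMap]
  exact forall_congr' fun x => ⟨fun h _ => mem_thicken_standardContour.2 h,
    fun h => mem_thicken_standardContour.1 (h Submodule.mem_top)⟩

theorem shiftZero_quotient_iff {v : Deg r} {ε : ℝ≥0} {S : GrSub M} :
    ShiftZero (ε • v) S.quotient ↔ (standardContour v).thicken ε S = ⊤ := by
  rw [shiftZero_iff_thicken_bot_eq_top, ← GrSub.comap_eq_top_iff_of_surjective S.mkQ_surjective,
    Contour.comap_thicken, GrSub.comap_mkQ_bot]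

theorem contourDim_standardContour (v : Deg r) (ε : ℝ≥0) (M : PersMod K r) :
    contourDim (standardContour v) ε M = shiftDim (ε • v) M :=
  congrArg sInf <| Set.ext fun _ => exists_congr fun _ => exists_congr fun _ =>
    shiftZero_quotient_iff.symm

end

theorem mainTheorem5 {K : Type u} [Field K] {r : ℕ} (v α : Deg r) (M : TameMod K r) (δ : ℝ≥0) :
    hierarchicalStabilization
        (noiseDist (((standardContour v).truncate α).noise K))
        (fun N : TameMod K r => betti₀ N.1) M δ
      = shiftDim (δ • v) (GrSub.above M.1 α).quotient := by
  rw [mainTheorem5_general ((rightContinuous_standardContour v).truncate α),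
    contourDim_truncate, contourDim_standardContour]
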